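/- Let $\Omega\subset\mathbb R^d$, $d\ge 1$, be a bounded open set, and let $\nu,T>0$. All spaces are real, and $H_0^1(\Omega)$ (the closure of $C_c^\infty(\Omega)$ in $H^1(\Omega)$) carries the inner product $(g,h)_{H_0^1}=(\nabla g,\nabla h)_{L^2}$. **Discretizations.** Let $N\ge 2$, $\Delta t=T/(N-1)$, let $V^h\subset H_0^1(\Omega)$ be a finite-dimensional subspace, let $f^1,\dots,f^N\in L^2(\Omega)$, and let $u^1,\dots,u^N\in V^h$ satisfy, for $1\le n\le N-1$, $$\Big(\tfrac{u^{n+1}-u^n}{\Delta t},v\Big)_{L^2}+\nu(\nabla u^{n+1},\nabla v)_{L^2}=(f^{n+1},v)_{L^2}\qquad\forall v\in V^h .$$ Put $w^1=u^1$, $\gamma_1=1$, and $w^{j+1}=(u^{j+1}-u^j)/\Delta t$, $\gamma_{j+1}=\Delta t$ for $1\le j\le N-1$. Let $\lambda_1\ge\lambda_2\ge\dots\ge 0$ and $\varphi_1,\varphi_2,\dots\in V^h$ (orthonormal in $H_0^1(\Omega)$) be the POD eigenvalues and POD modes: $\{\lambda_i^{1/2},g_i,\varphi_i\}$ is a singular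 value decomposition of the operator $K g=\sum_{j=1}^N\gamma_j g^j w^j$ from $\mathbb R^N$, with inner product $\sum_j\gamma_j g^jh^j$, to $H_0^1(\Omega)$; finitely many modes are given, including all those with $\lambda_i>0$. Let $s$ be the number of positive $\lambda_i$. Let $r\ge 0$ be at most the number of modes, $X_r=\mathrm{span}\{\varphi_1,\dots,\varphi_r\}$, and let $u_r^1,\dots,u_r^N\in X_r$ satisfy $u_r^1=\sum_{i=1}^r(u^1,\varphi_i)_{H_0^1}\varphi_i$ and, for $1\le n\le N-1$, $$\Big(\tfrac{u_r^{n+1}-u_r^n}{\Delta t},v\Big)_{L^2}+\nu(\nabla u_r^{n+1},\nabla v)_{L^2}=(f^{n+1},v)_{L^2}\qquad\forall v\in X_r .$$ Write $e^k=u^k-u_r^k$ and $\phi_r^1=u_r^1-R_ru^1$, where $R_r$ is the Ritz projection onto $X_r$, i.e. $(\nabla(w-R_rw),\nabla v)_{L^2}=0$ for all $v\in X_r$. Set $$E_{L^2}=\sum_{i=r+1}^s\lambda_i\|\varphi_i\|_{L^2}^2+\|\phi_r^1\|_{L^2}^2,\qquad E_{H_0^1}=\sum_{i=r+1}^s\lambda_i\big(\|\varphi_i\|_{L^2}^2+1\big)+\|\phi_r^1\|_{H_0^1}^2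 .$$ **Optimality.** Let $Y=L^2(\Omega)$ or $Y=H_0^1(\Omega)$, and let $\Pi_r^Y$ be the $Y$-orthogonal projection onto $X_r$. A real-valued quantity $E$, defined for every discretization, is called, on a class of discretizations, *optimal-I* (with respect to $Y$) if there is a constant $C$, the same for all discretizations in the class, with $E\le C\sum_{i=r+1}^s\lambda_i\|\varphi_i\|_Y^2$; and *optimal-II* if there is such a $C$ with $E\le C\sum_{i=r+1}^s\lambda_i\|\varphi_i-\Pi_r^Y\varphi_i\|_Y^2$. **Theorem.** For fixed $\Omega,\nu,T$ the following hold. 1. There is a constant $C$ with $\max_{1\le k\le N}\|e^k\|_{L^2}^2\le C\,E_{L^2}$ for all discretizations, and $E_{L^2}$ is optimal-I with respect to $Y=L^2(\Omega)$ on the class of all discretizations. 2. For every constant $C_0$, $E_{L^2}$ is optimal-II with respect to $Y=L^2(\Omega)$ on the class of all discretizations with $\|\varphi_i\|_{L^2}\le C_0\|\varphi_i-\Pi_r^{L^2}\varphi_i\|_{L^2}$ for $r+1\le i\le s$. 3. There is a constant $C$ with $\max_{1\le k\le N}\|e^k\|_{H_0^1}^2\le C\,E_{H_0^1}$ for all discretizations,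 and $E_{H_0^1}$ is optimal-I and optimal-II with respect to $Y=H_0^1(\Omega)$ on the class of all discretizations. Moreover, for $Y=H_0^1(\Omega)$, on every class of discretizations and for every quantity $E$, optimal-I and optimal-II are equivalent. -/

import Mathlib

open MeasureTheory
open scoped ContDiff

noncomputable section

namespace PODRom

/-! ### The spaces `L²(Ω)` and `H₀¹(Ω)` (real-valued) -/

/-- A bounded open subset `Ω` of `ℝᵈ`. -/
structure BoundedDomain (d : ℕ) where
  carrier : Set (EuclideanSpace ℝ (Fin d))
  isOpen : IsOpen carrier
  isBounded : Bornology.IsBounded carrier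

variable {d : ℕ}

/-- Lebesgue measure on `Ω`. -/
abbrev vol (Ω : BoundedDomain d) : Measure (EuclideanSpace ℝ (Fin d)) :=
  volume.restrict Ω.carrier

/-- `L²(Ω)`. -/
abbrev L2 (Ω : BoundedDomain d) : Type := Lp ℝ 2 (vol Ω)

/-- `L²(Ω; ℝᵈ)`. -/
abbrev L2Vec (Ω : BoundedDomain d) : Type := Lp (EuclideanSpace ℝ (Fin d)) 2 (vol Ω)

/-- Test functions: smooth with compact support contained in `Ω`. -/
def IsTestFunction (Ω : BoundedDomain d) (ψ : EuclideanSpace ℝ (Fin d) → ℝ) : Prop :=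
  ContDiff ℝ ∞ ψ ∧ HasCompactSupport ψ ∧ tsupport ψ ⊆ Ω.carrier

/-- The pairs `(ψ, ∇ψ)` in `L²(Ω) × L²(Ω; ℝᵈ)` with `ψ ∈ C_c^∞(Ω)`. -/
def testGraph (Ω : BoundedDomain d) : Submodule ℝ (L2 Ω × L2Vec Ω) where
  carrier := {p | ∃ ψ, IsTestFunction Ω ψ ∧ p.1 =ᵐ[vol Ω] ψ ∧ p.2 =ᵐ[vol Ω] gradient ψ}
  zero_mem' := by
    refine ⟨fun _ => 0, ⟨contDiff_const, HasCompactSupport.zero, by simp [tsupport]⟩, ?_, ?_⟩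
    · exact Lp.coeFn_zero _ _ _
    · rw [gradient_fun_const']
      exact Lp.coeFn_zero _ _ _
  add_mem' := by
    rintro p q ⟨a, ⟨ha, hac, has⟩, hp, hp'⟩ ⟨b, ⟨hb, hbc, hbs⟩, hq, hq'⟩
    refine ⟨a + b, ⟨ha.add hb, hac.add hbc, (tsupport_add _ _).trans (Set.union_subset has hbs)⟩,
      ?_, ?_⟩
    · filter_upwards [Lp.coeFn_add p.1 q.1, hp, hq] with x h1 h2 h3
      rw [Prod.fst_add, h1, Pi.add_apply, Pi.add_apply, h2, h3]
    · filter_upwards [Lp.coeFn_add p.2 q.2, hp', hq'] with x h1 h2 h3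
      rw [Prod.snd_add, h1, Pi.add_apply, h2, h3]
      simp only [gradient]
      rw [fderiv_add (ha.differentiable (by simp) x) (hb.differentiable (by simp) x), map_add]
  smul_mem' := by
    rintro c p ⟨a, ⟨ha, hac, has⟩, hp, hp'⟩
    refine ⟨c • a, ⟨contDiff_const.smul ha, hac.smul_left, ?_⟩, ?_, ?_⟩
    · exact (closure_mono (Function.support_const_smul_subset c a)).trans has
    · filter_upwards [Lp.coeFn_smul c p.1, hp] with x h1 h2
      rw [Prod.smul_fst, h1, Pi.smul_apply, Pi.smul_apply, h2]
    · filter_upwards [Lp.coeFn_smul c p.2, hp'] with x h1 h2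
      rw [Prod.smul_snd, h1, Pi.smul_apply, h2]
      simp only [gradient]
      rw [fderiv_const_smul (ha.differentiable (by simp) x)]
      simp

/-- `H₀¹(Ω)`, the closure of `C_c^∞(Ω)` in the `H¹` norm: the limits of pairs `(ψₙ, ∇ψₙ)` in
`L²(Ω) × L²(Ω; ℝᵈ)`.  An element is a function `u` together with its weak gradient `∇u`. -/
def H10 (Ω : BoundedDomain d) : Type := (testGraph Ω).topologicalClosure

instance (Ω : BoundedDomain d) : AddCommGroup (H10 Ω) :=
  inferInstanceAs (AddCommGroup (testGraph Ω).topologicalClosure)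

instance (Ω : BoundedDomain d) : Module ℝ (H10 Ω) :=
  inferInstanceAs (Module ℝ (testGraph Ω).topologicalClosure)

/-- The embedding `H₀¹(Ω) → L²(Ω)`. -/
def toL2 (Ω : BoundedDomain d) : H10 Ω →ₗ[ℝ] L2 Ω :=
  LinearMap.fst ℝ (L2 Ω) (L2Vec Ω) ∘ₗ (testGraph Ω).topologicalClosure.subtype

/-- The weak gradient `∇ : H₀¹(Ω) → L²(Ω; ℝᵈ)`. -/
def grad (Ω : BoundedDomain d) : H10 Ω →ₗ[ℝ] L2Vec Ω :=
  LinearMap.snd ℝ (L2 Ω) (L2Vec Ω) ∘ₗ (testGraph Ω).topologicalClosure.subtype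

/-- `grad` is the weak gradient: integration by parts against test functions. -/
theorem integral_toL2_mul_fderiv {Ω : BoundedDomain d} (u : H10 Ω)
    {ψ : EuclideanSpace ℝ (Fin d) → ℝ} (h : IsTestFunction Ω ψ) (v : EuclideanSpace ℝ (Fin d)) :
    ∫ x in Ω.carrier, toL2 Ω u x * fderiv ℝ ψ x v
      = -∫ x in Ω.carrier, inner ℝ (grad Ω u x) v * ψ x := by
  obtain ⟨hs, hc, hsub⟩ := h
  have hcont : Continuous ψ := hs.continuous
  have hgc : Continuous (fderiv ℝ ψ) := hs.continuous_fderiv (by simp)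
  have hcd : HasCompactSupport (fun x => fderiv ℝ ψ x v) := hc.fderiv_apply (𝕜 := ℝ) v
  have ma : MemLp (fun x => fderiv ℝ ψ x v) 2 (vol Ω) :=
    Continuous.memLp_of_hasCompactSupport (by fun_prop) hcd
  have mb : MemLp (fun x => ψ x • v) 2 (vol Ω) :=
    Continuous.memLp_of_hasCompactSupport (by fun_prop) hc.smul_right
  have ca : ∀ p : L2 Ω, inner ℝ p ma.toLp = ∫ x in Ω.carrier, p x * fderiv ℝ ψ x v := by
    intro p
    rw [L2.inner_def]
    apply integral_congr_ae
    filter_upwards [ma.coeFn_toLp] with x hx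
    rw [hx]; simp [mul_comm]
  have cb : ∀ p : L2Vec Ω, inner ℝ p mb.toLp = ∫ x in Ω.carrier, inner ℝ (p x) v * ψ x := by
    intro p
    rw [L2.inner_def]
    apply integral_congr_ae
    filter_upwards [mb.coeFn_toLp] with x hx
    rw [hx, inner_smul_right, mul_comm]
  have hcl : IsClosed {p : L2 Ω × L2Vec Ω | inner ℝ p.1 ma.toLp = -inner ℝ p.2 mb.toLp} :=
    isClosed_eq (by fun_prop) (by fun_prop)
  have hsubs : ((testGraph Ω : Submodule ℝ (L2 Ω × L2Vec Ω)) : Set (L2 Ω × L2Vec Ω)) ⊆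
      {p | inner ℝ p.1 ma.toLp = -inner ℝ p.2 mb.toLp} := by
    rintro p ⟨a, ⟨ha, hac, has⟩, h1, h2⟩
    have hacont : Continuous a := ha.continuous
    have hagc : Continuous (fderiv ℝ a) := ha.continuous_fderiv (by simp)
    have hz : ∀ x, x ∉ Ω.carrier → a x = 0 := fun x hx =>
      image_eq_zero_of_notMem_tsupport (fun h => hx (has h))
    have hz' : ∀ x, x ∉ Ω.carrier → ψ x = 0 := fun x hx =>
      image_eq_zero_of_notMem_tsupport (fun h => hx (hsub h))
    change inner ℝ p.1 ma.toLp = -inner ℝ p.2 mb.toLp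
    rw [ca, cb]
    have e1 : ∫ x in Ω.carrier, p.1 x * fderiv ℝ ψ x v = ∫ x, a x * fderiv ℝ ψ x v := by
      rw [← setIntegral_eq_integral_of_forall_compl_eq_zero (s := Ω.carrier)
        (f := fun x => a x * fderiv ℝ ψ x v) (fun x hx => by simp [hz x hx])]
      apply integral_congr_ae
      filter_upwards [h1] with x hx
      rw [hx]
    have e2 : ∫ x in Ω.carrier, inner ℝ (p.2 x) v * ψ x = ∫ x, fderiv ℝ a x v * ψ x := by
      rw [← setIntegral_eq_integral_of_forall_compl_eq_zero (s := Ω.carrier)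
        (f := fun x => fderiv ℝ a x v * ψ x) (fun x hx => by simp [hz' x hx])]
      apply integral_congr_ae
      filter_upwards [h2] with x hx
      rw [hx, inner_gradient_left]
    rw [e1, e2]
    apply integral_mul_fderiv_eq_neg_fderiv_mul_of_integrable
    · exact Continuous.integrable_of_hasCompactSupport (by fun_prop) hc.mul_left
    · exact Continuous.integrable_of_hasCompactSupport (by fun_prop) hac.mul_right
    · exact Continuous.integrable_of_hasCompactSupport (by fun_prop) hac.mul_right
    · exact fun x _ => ha.differentiable (by simp) x
    · exact fun x _ => hs.differentiable (by simp) x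
  have := closure_minimal hsubs hcl u.2
  change inner ℝ (toL2 Ω u) ma.toLp = -inner ℝ (grad Ω u) mb.toLp at this
  rwa [ca, cb] at this

theorem poincare_test {Ω : BoundedDomain d} {ψ : EuclideanSpace ℝ (Fin d) → ℝ}
    (h : IsTestFunction Ω ψ) {R : ℝ} (hR : ∀ x ∈ Ω.carrier, ‖x‖ ≤ R) (i : Fin d) :
    ∫ x in Ω.carrier, ψ x ^ 2 ≤ 4 * R ^ 2 * ∫ x in Ω.carrier, ‖gradient ψ x‖ ^ 2 := by
  obtain ⟨hs, hc, hsub⟩ := h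
  have hcont : Continuous ψ := hs.continuous
  have hdiff : Differentiable ℝ ψ := hs.differentiable (by simp)
  have hgc : Continuous (fderiv ℝ ψ) := hs.continuous_fderiv (by simp)
  set v : EuclideanSpace ℝ (Fin d) := EuclideanSpace.single i 1 with hv
  have hvn : ‖v‖ = 1 := by simp [hv]
  let l : EuclideanSpace ℝ (Fin d) →L[ℝ] ℝ := innerSL ℝ v
  have hdl : ∀ x, fderiv ℝ (fun y => l y) x = l := fun x => l.fderiv
  have hlv : l v = 1 := by simp [l, hvn]
  have hd2 : ∀ x, fderiv ℝ (fun y => ψ y ^ 2) x v = 2 * ψ x * fderiv ℝ ψ x v := by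
    intro x
    rw [fderiv_fun_pow 2 (hdiff x)]
    simp
  have hgr : ∀ x, ‖gradient ψ x‖ = ‖fderiv ℝ ψ x‖ := by
    intro x; simp [gradient]
  have hc2 : HasCompactSupport (fun x => ψ x ^ 2) := by
    simp only [pow_two]
    exact hc.mul_left (f := ψ)
  have i1 : Integrable (fun x => ψ x ^ 2) := (hcont.pow 2).integrable_of_hasCompactSupport hc2
  have i2 : Integrable (fun x => l x * (2 * ψ x * fderiv ℝ ψ x v)) := by
    apply Continuous.integrable_of_hasCompactSupport
    · fun_prop
    · exact (hc.mul_left (f := fun _ => (2 : ℝ))).mul_right.mul_left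
  have i3 : Integrable (fun x => l x * ψ x ^ 2) := by
    apply Continuous.integrable_of_hasCompactSupport
    · fun_prop
    · exact hc2.mul_left
  have i4 : Integrable (fun x => ‖fderiv ℝ ψ x‖ ^ 2) := by
    apply Continuous.integrable_of_hasCompactSupport
    · fun_prop
    · have : HasCompactSupport (fun x => ‖fderiv ℝ ψ x‖) := (hc.fderiv (𝕜 := ℝ)).norm
      simp only [pow_two]
      exact this.mul_left (f := fun x => ‖fderiv ℝ ψ x‖)
  have key := integral_mul_fderiv_eq_neg_fderiv_mul_of_integrable (μ := volume)
    (f := fun x => l x) (g := fun x => ψ x ^ 2) (v := v)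
    (by simpa [hdl, hlv] using i1) (by simpa [hd2] using i2) i3
    (fun x _ => l.differentiableAt) (fun x _ => (hdiff x).pow 2)
  simp only [hdl, hlv, hd2, one_mul] at key
  have hz : ∀ x, x ∉ Ω.carrier → ψ x = 0 := fun x hx =>
    image_eq_zero_of_notMem_tsupport (fun h => hx (hsub h))
  have e1 : ∫ x in Ω.carrier, ψ x ^ 2 = ∫ x, ψ x ^ 2 :=
    setIntegral_eq_integral_of_forall_compl_eq_zero (fun x hx => by simp [hz x hx])
  have e2 : ∫ x in Ω.carrier, l x * (2 * ψ x * fderiv ℝ ψ x v)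
      = ∫ x, l x * (2 * ψ x * fderiv ℝ ψ x v) :=
    setIntegral_eq_integral_of_forall_compl_eq_zero (fun x hx => by simp [hz x hx])
  have e3 : ∫ x in Ω.carrier, ψ x ^ 2
      = ∫ x in Ω.carrier, -(l x * (2 * ψ x * fderiv ℝ ψ x v)) := by
    rw [integral_neg, e1, e2, key, neg_neg]
  have e4 : ∫ x in Ω.carrier, -(l x * (2 * ψ x * fderiv ℝ ψ x v))
      ≤ ∫ x in Ω.carrier, ((1 / 2) * ψ x ^ 2 + 2 * R ^ 2 * ‖fderiv ℝ ψ x‖ ^ 2) := by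
    apply setIntegral_mono_on i2.neg.integrableOn
      ((i1.const_mul _).add (i4.const_mul _)).integrableOn Ω.isOpen.measurableSet
    intro x hx
    have h1 : |l x| ≤ R := by
      have := l.le_opNorm x
      rw [innerSL_apply_norm, hvn, one_mul, Real.norm_eq_abs] at this
      exact this.trans (hR x hx)
    have h2 : |fderiv ℝ ψ x v| ≤ ‖fderiv ℝ ψ x‖ := by
      have := (fderiv ℝ ψ x).le_opNorm v
      rwa [hvn, mul_one, Real.norm_eq_abs] at this
    have h3 : |l x * fderiv ℝ ψ x v| ≤ R * ‖fderiv ℝ ψ x‖ := by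
      rw [abs_mul]
      exact mul_le_mul h1 h2 (abs_nonneg _) ((abs_nonneg _).trans h1)
    have h4 : (l x * fderiv ℝ ψ x v) ^ 2 ≤ (R * ‖fderiv ℝ ψ x‖) ^ 2 := by
      rw [← sq_abs]; gcongr
    change -(l x * (2 * ψ x * fderiv ℝ ψ x v))
      ≤ (1 / 2) * ψ x ^ 2 + 2 * R ^ 2 * ‖fderiv ℝ ψ x‖ ^ 2
    nlinarith [sq_nonneg (ψ x + 2 * (l x * fderiv ℝ ψ x v))]
  rw [integral_add (i1.const_mul _).integrableOn (i4.const_mul _).integrableOn,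
    integral_const_mul, integral_const_mul] at e4
  simp only [hgr]
  linarith

/-- Poincaré's inequality on `H₀¹(Ω)`. -/
theorem poincare [NeZero d] (Ω : BoundedDomain d) :
    ∃ C : ℝ, ∀ u : H10 Ω, ‖toL2 Ω u‖ ^ 2 ≤ C * ‖grad Ω u‖ ^ 2 := by
  obtain ⟨R, hR⟩ := Ω.isBounded.exists_norm_le
  refine ⟨4 * R ^ 2, fun u => ?_⟩
  have hcl : IsClosed {p : L2 Ω × L2Vec Ω | ‖p.1‖ ^ 2 ≤ 4 * R ^ 2 * ‖p.2‖ ^ 2} :=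
    isClosed_le (by fun_prop) (by fun_prop)
  have hsub : ((testGraph Ω : Submodule ℝ (L2 Ω × L2Vec Ω)) : Set (L2 Ω × L2Vec Ω)) ⊆
      {p | ‖p.1‖ ^ 2 ≤ 4 * R ^ 2 * ‖p.2‖ ^ 2} := by
    rintro p ⟨ψ, hψ, h1, h2⟩
    have hle := poincare_test hψ hR (0 : Fin d)
    have e1 : ‖p.1‖ ^ 2 = ∫ x in Ω.carrier, ψ x ^ 2 := by
      rw [← real_inner_self_eq_norm_sq, L2.inner_def]
      apply integral_congr_ae
      filter_upwards [h1] with x hx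
      rw [hx, real_inner_self_eq_norm_sq, Real.norm_eq_abs, sq_abs]
    have e2 : ‖p.2‖ ^ 2 = ∫ x in Ω.carrier, ‖gradient ψ x‖ ^ 2 := by
      rw [← real_inner_self_eq_norm_sq, L2.inner_def]
      apply integral_congr_ae
      filter_upwards [h2] with x hx
      rw [hx, real_inner_self_eq_norm_sq]
    simpa [e1, e2] using hle
  exact closure_minimal hsub hcl u.2

theorem grad_injective [NeZero d] (Ω : BoundedDomain d) : Function.Injective (grad Ω) := by
  rw [injective_iff_map_eq_zero]
  intro u hu
  obtain ⟨C, hC⟩ := poincare Ω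
  have h := hC u
  rw [hu] at h
  have h0 : toL2 Ω u = 0 := by
    have : ‖toL2 Ω u‖ ^ 2 ≤ 0 := by simpa using h
    have h' : ‖toL2 Ω u‖ = 0 := by
      nlinarith [norm_nonneg (toL2 Ω u), sq_nonneg ‖toL2 Ω u‖]
    simpa using h'
  exact Subtype.ext (Prod.ext h0 hu)

/-- `H₀¹(Ω)` carries the norm `‖u‖ = ‖∇u‖_{L²}`. -/
instance [NeZero d] (Ω : BoundedDomain d) : NormedAddCommGroup (H10 Ω) :=
  NormedAddCommGroup.induced (H10 Ω) (L2Vec Ω) (grad Ω) (grad_injective Ω)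

/-- `H₀¹(Ω)` carries the inner product `(g, h) = (∇g, ∇h)_{L²}`. -/
instance [NeZero d] (Ω : BoundedDomain d) : InnerProductSpace ℝ (H10 Ω) where
  norm_smul_le c u := by
    change ‖grad Ω (c • u)‖ ≤ ‖c‖ * ‖grad Ω u‖
    rw [map_smul, norm_smul]
  inner u v := inner ℝ (grad Ω u) (grad Ω v)
  norm_sq_eq_re_inner u := norm_sq_eq_re_inner (𝕜 := ℝ) (grad Ω u)
  conj_inner_symm u v := inner_conj_symm (𝕜 := ℝ) (grad Ω u) (grad Ω v)
  add_left u v w := by rw [map_add, inner_add_left]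
  smul_left u v c := by rw [map_smul, inner_smul_left]

/-! ### Proper orthogonal decomposition -/

section POD

variable {X : Type*} [NormedAddCommGroup X] [InnerProductSpace ℝ X]

/-- The weighted inner product of `S = ℝ^M`. -/
def weightedInner {M : ℕ} (γ : Fin M → ℝ) (g h : Fin M → ℝ) : ℝ := ∑ j, γ j * g j * h j

/-- The POD operator `K : S → X` of the snapshots `w` with weights `γ`. -/
def podOperator {M : ℕ} (γ : Fin M → ℝ) (w : Fin M → X) (g : Fin M → ℝ) : X :=
  ∑ j, (γ j * g j) • w j

/-- `lam` and `φ` are the first `p` POD eigenvalues (in decreasing order) and POD modes of the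
snapshots `w`: there are `S`-orthonormal `g i` such that `(√(lam i), g i, φ i)` is a singular value
decomposition of the POD operator.  The number `p` is arbitrary as long as all positive singular
values are present; modes of zero singular values are allowed. -/
structure IsPOD {M p : ℕ} (γ : Fin M → ℝ) (w : Fin M → X) (lam : Fin p → ℝ) (φ : Fin p → X) :
    Prop where
  antitone : Antitone lam
  nonneg : ∀ i, 0 ≤ lam i
  orthonormal : Orthonormal ℝ φ
  svd : ∃ g : Fin p → Fin M → ℝ,
    (∀ i k, weightedInner γ (g i) (g k) = if i = k then 1 else 0) ∧
    ∀ h, podOperator γ w h = ∑ i, (√(lam i) * weightedInner γ h (g i)) • φ i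

/-- The weights `1, Δt, …, Δt` of the POD problem with one snapshot and all difference
quotients. -/
def dqWeights {m : ℕ} (Δt : ℝ) : Fin (m + 1) → ℝ := Fin.cons 1 fun _ => Δt

/-- The snapshots `u¹, ∂u¹, …, ∂u^{N-1}` of the POD problem with one snapshot and all difference
quotients, `∂uʲ = (u^{j+1} - uʲ) / Δt` (here `N = m + 1`, and the times are numbered from `0`). -/
def dqSnapshots {m : ℕ} (Δt : ℝ) (u : Fin (m + 1) → X) : Fin (m + 1) → X :=
  Fin.cons (u 0) fun j : Fin m => (1 / Δt) • (u j.succ - u j.castSucc)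

/-- The span of the first `r` modes. -/
def modeSpace {p : ℕ} (φ : Fin p → X) (r : ℕ) : Submodule ℝ X :=
  Submodule.span ℝ (φ '' {i | (i : ℕ) < r})

instance {p : ℕ} (φ : Fin p → X) (r : ℕ) : FiniteDimensional ℝ (modeSpace φ r) :=
  FiniteDimensional.span_of_finite ℝ (Set.toFinite _)

/-- The POD projection `Π_r^X x = ∑_{i ≤ r} (x, φ_i)_X φ_i`. -/
def podProj {p : ℕ} (φ : Fin p → X) (r : ℕ) (x : X) : X :=
  ∑ i ∈ Finset.univ.filter (fun i : Fin p => (i : ℕ) < r), inner ℝ x (φ i) • φ i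

end POD

/-! ### The reduced order model -/

variable [NeZero d]

/-- Fix `Ω`, `ν` and `T`.  A discretization of the heat equation on `Ω × [0, T]` with
homogeneous Dirichlet data, with its `H₀¹` POD basis and its reduced order model.  There are
`N = m + 1` time levels, numbered by `0, …, m`. -/
structure Discretization (Ω : BoundedDomain d) (ν T : ℝ) where
  /-- number of time steps -/
  m : ℕ
  m_pos : 0 < m
  /-- conforming finite element space -/
  Vh : Submodule ℝ (H10 Ω)
  finiteDimensional : FiniteDimensional ℝ Vh
  /-- forcing at the time levels -/
  f : Fin (m + 1) → L2 Ω
  /-- finite element solution -/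
  u : Fin (m + 1) → H10 Ω
  u_mem : ∀ n, u n ∈ Vh
  /-- backward Euler with `Δt = T / m` -/
  backwardEuler : ∀ n : Fin m, ∀ v ∈ Vh,
    inner ℝ (toL2 Ω ((1 / (T / m)) • (u n.succ - u n.castSucc))) (toL2 Ω v)
      + ν * inner ℝ (grad Ω (u n.succ)) (grad Ω v) = inner ℝ (f n.succ) (toL2 Ω v)
  /-- number of computed POD modes -/
  p : ℕ
  /-- POD eigenvalues -/
  lam : Fin p → ℝ
  /-- POD modes -/
  φ : Fin p → H10 Ω
  φ_mem : ∀ i, φ i ∈ Vh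
  isPOD : IsPOD (dqWeights (T / m)) (dqSnapshots (T / m) u) lam φ
  /-- number of modes used in the reduced order model -/
  r : ℕ
  r_le : r ≤ p
  /-- solution of the reduced order model -/
  ur : Fin (m + 1) → H10 Ω
  ur_mem : ∀ n, ur n ∈ modeSpace φ r
  ur_initial : ur 0 = podProj φ r (u 0)
  rom : ∀ n : Fin m, ∀ v ∈ modeSpace φ r,
    inner ℝ (toL2 Ω ((1 / (T / m)) • (ur n.succ - ur n.castSucc))) (toL2 Ω v)
      + ν * inner ℝ (grad Ω (ur n.succ)) (grad Ω v) = inner ℝ (f n.succ) (toL2 Ω v)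

namespace Discretization

variable {Ω : BoundedDomain d} {ν T : ℝ}

/-- The reduced space `X_r`, the span of the first `r` POD modes. -/
abbrev Xr (D : Discretization Ω ν T) : Submodule ℝ (H10 Ω) := modeSpace D.φ D.r

/-- The number `s` of positive POD eigenvalues. -/
def s (D : Discretization Ω ν T) : ℕ := Fintype.card {i : Fin D.p // 0 < D.lam i}

/-- The indices `i = r + 1, …, s` (which are `r, …, s - 1` when counting from `0`). -/
def tail (D : Discretization Ω ν T) : Finset (Fin D.p) := 
  Finset.univ.filter fun i => D.r ≤ (i : ℕ) ∧ (i : ℕ) < D.s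

/-- The error `eᵏ = uᵏ - u_rᵏ`. -/
def err (D : Discretization Ω ν T) (k : Fin (D.m + 1)) : H10 Ω := D.u k - D.ur k

/-- The Ritz projection `R_r` onto `X_r`, i.e. the orthogonal projection for `(∇·, ∇·)_{L²}`. -/
def ritz (D : Discretization Ω ν T) (x : H10 Ω) : H10 Ω := D.Xr.starProjection x

/-- The initial discretization error `φ_r¹ = u_r¹ - R_r u¹`. -/
def initErr (D : Discretization Ω ν T) : H10 Ω := D.ur 0 - D.ritz (D.u 0)

/-- The total ROM discretization error `Λ_r + Λ_r¹` of the `L²` error bound. -/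
def totalErrL2 (D : Discretization Ω ν T) : ℝ :=
  ∑ i ∈ D.tail, D.lam i * ‖toL2 Ω (D.φ i)‖ ^ 2 + ‖toL2 Ω D.initErr‖ ^ 2

/-- The total ROM discretization error `Λ_r + Λ_r¹` of the `H₀¹` error bound. -/
def totalErrH10 (D : Discretization Ω ν T) : ℝ :=
  ∑ i ∈ D.tail, D.lam i * (‖toL2 Ω (D.φ i)‖ ^ 2 + 1) + ‖D.initErr‖ ^ 2

section Optimality

variable {Y : Type*} [NormedAddCommGroup Y] [InnerProductSpace ℝ Y]

/-- The `Y`-orthogonal projection `Π_r^Y y` of `y` onto `X_r`, the latter regarded as a subspace of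
`Y` through the embedding `J`. -/
def projY (D : Discretization Ω ν T) (J : H10 Ω →ₗ[ℝ] Y) (y : Y) : Y :=
  (D.Xr.map J).starProjection y

end Optimality

end Discretization

section Optimality

variable {Ω : BoundedDomain d} {ν T : ℝ} {Y : Type*} [NormedAddCommGroup Y] [InnerProductSpace ℝ Y]

/-- `Λ` bounds the pointwise error in the norm of `Y` up to a constant, uniformly over all
discretizations in `𝓓`.  The space `Y` comes with an embedding `J` of `H₀¹(Ω)`. -/
def BoundsPointwiseError (𝓓 : Set (Discretization Ω ν T)) (J : H10 Ω →ₗ[ℝ] Y)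
    (Λ : Discretization Ω ν T → ℝ) : Prop :=
  ∃ C : ℝ, ∀ D ∈ 𝓓, ∀ k, ‖J (D.err k)‖ ^ 2 ≤ C * Λ D

/-- `Λ` is optimal-I, with a constant that is the same for all discretizations in `𝓓`. -/
def OptimalI (𝓓 : Set (Discretization Ω ν T)) (J : H10 Ω →ₗ[ℝ] Y)
    (Λ : Discretization Ω ν T → ℝ) : Prop :=
  ∃ C : ℝ, ∀ D ∈ 𝓓, Λ D ≤ C * ∑ i ∈ D.tail, D.lam i * ‖J (D.φ i)‖ ^ 2

/-- `Λ` is optimal-II, with a constant that is the same for all discretizations in `𝓓`. -/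
def OptimalII (𝓓 : Set (Discretization Ω ν T)) (J : H10 Ω →ₗ[ℝ] Y)
    (Λ : Discretization Ω ν T → ℝ) : Prop :=
  ∃ C : ℝ, ∀ D ∈ 𝓓,
    Λ D ≤ C * ∑ i ∈ D.tail, D.lam i * ‖J (D.φ i) - D.projY J (J (D.φ i))‖ ^ 2

end Optimality

end PODRom

end

namespace PODRom

/-! Expanding each snapshot in the singular value decomposition gives, for every linear map `A`, the
identity `∑ γ_j ‖A w_j‖² = ∑ λ_i ‖A φ_i‖²` (`IsPOD.sum_norm_sq_map`). Take for `A` the Ritz residual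
`η = x - R_r x`, measured in `L²` or `H₀¹`. By orthonormality `R_r` fixes the first `r` modes and
annihilates the others, so the right side is exactly the tail sum. The snapshots are the initial
value and all difference quotients, so the tail controls both `η¹` and the discrete time derivative
of `η`. A discrete fundamental theorem of calculus then bounds every `ηᵏ`, with a constant depending
only on `T` (`norm_sq_ritzResidual_le`).

The error is `eᵏ = ηᵏ - φ_rᵏ` with `φ_rᵏ = u_rᵏ - R_r uᵏ` in `X_r`. Subtracting the two schemes
shows that `φ_r` solves backward Euler with the difference quotients of `η` as forcing; the gradient
of `η` drops out by Ritz orthogonality. Its initial value is zero, since the POD projection in `H₀¹`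
is the Ritz projection. Two energy estimates, `backwardEuler_norm_sq_map_le` and
`backwardEuler_norm_sq_le`, bound it by the `L²` tail.

With `φ_r¹ = 0` the total errors are tail sums, so optimality needs only Poincaré's inequality in
`H₀¹`. There the discarded modes are orthogonal to `X_r`, and the two notions coincide. -/

theorem le_add_sum_of_succ_le {m : ℕ} (a : Fin (m + 1) → ℝ) (b : Fin m → ℝ) (hb : ∀ n, 0 ≤ b n)
    (h : ∀ n : Fin m, a n.succ ≤ a n.castSucc + b n) (k : Fin (m + 1)) :
    a k ≤ a 0 + ∑ n, b n := by
  -- The sharper bound by the increments before `k` is what the induction proves; nonnegativity of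
  -- `b` then completes the sum.
  have key : ∀ k : Fin (m + 1),
      a k ≤ a 0 + ∑ n ∈ Finset.univ.filter (fun n : Fin m => (n : ℕ) < k), b n := by
    intro k
    induction k using Fin.induction with
    | zero => simp
    | succ n ih =>
      have hs : Finset.univ.filter (fun j : Fin m => (j : ℕ) < (n.succ : Fin (m + 1)))
          = insert n (Finset.univ.filter (fun j : Fin m => (j : ℕ) < (n.castSucc : Fin (m + 1)))) := by
        ext j
        simp [Fin.ext_iff]
        omega
      rw [hs, Finset.sum_insert (by simp)]
      linarith [h n]
  have := Finset.sum_le_sum_of_subset_of_nonneg (f := b)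
    (Finset.subset_univ (Finset.univ.filter (fun n : Fin m => (n : ℕ) < k))) fun n _ _ => hb n
  linarith [key k]

/-! ### POD identities, projections and backward Euler estimates in inner product spaces -/

section POD

variable {X Y : Type*} [NormedAddCommGroup X] [InnerProductSpace ℝ X]
  [NormedAddCommGroup Y] [InnerProductSpace ℝ Y]

/-- The POD error formula for the image of the snapshots under a linear map. -/
theorem IsPOD.sum_norm_sq_map {M p : ℕ} {γ : Fin M → ℝ} {w : Fin M → X} {lam : Fin p → ℝ}
    {φ : Fin p → X} (h : IsPOD γ w lam φ) (hγ : ∀ j, 0 < γ j) (A : X →ₗ[ℝ] Y) :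
    ∑ j, γ j * ‖A (w j)‖ ^ 2 = ∑ i, lam i * ‖A (φ i)‖ ^ 2 := by
  obtain ⟨g, hg, hK⟩ := h.svd
  have hw : ∀ j, w j = ∑ i, (√(lam i) * g i j) • φ i := by
    intro j
    -- The weight is divided out so that `K` returns exactly the snapshot `w j`.
    have := hK (Pi.single j (1 / γ j))
    simpa [podOperator, weightedInner, Pi.single_apply, (hγ j).ne'] using this
  have hn : ∀ j, γ j * ‖A (w j)‖ ^ 2 = ∑ i, ∑ k, (γ j * g i j * g k j) *
      (√(lam i) * √(lam k) * inner ℝ (A (φ i)) (A (φ k))) := by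
    intro j
    rw [hw j, ← real_inner_self_eq_norm_sq, map_sum, sum_inner, Finset.mul_sum]
    refine Finset.sum_congr rfl fun i _ => ?_
    rw [inner_sum, Finset.mul_sum]
    refine Finset.sum_congr rfl fun k _ => ?_
    simp only [map_smul, real_inner_smul_left, real_inner_smul_right]
    ring
  simp_rw [hn]
  rw [Finset.sum_comm]
  refine Finset.sum_congr rfl fun i _ => ?_
  rw [Finset.sum_comm]
  simp_rw [← Finset.sum_mul]
  -- Orthonormality in the weighted inner product removes all off-diagonal terms.
  have hg' : ∀ k, ∑ j, γ j * g i j * g k j = if i = k then 1 else 0 := fun k => hg i k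
  simp_rw [hg']
  simp only [ite_mul, one_mul, zero_mul, Finset.sum_ite_eq, Finset.mem_univ, if_true]
  rw [Real.mul_self_sqrt (h.nonneg i), real_inner_self_eq_norm_sq]

theorem starProjection_modeSpace_of_lt {p : ℕ} (φ : Fin p → X) {r : ℕ} {i : Fin p}
    (hi : (i : ℕ) < r) : (modeSpace φ r).starProjection (φ i) = φ i :=
  Submodule.starProjection_eq_self_iff.2 (Submodule.subset_span ⟨i, hi, rfl⟩)

theorem starProjection_modeSpace_of_le {p : ℕ} {φ : Fin p → X} (hφ : Orthonormal ℝ φ) {r : ℕ}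
    {i : Fin p} (hi : r ≤ (i : ℕ)) : (modeSpace φ r).starProjection (φ i) = 0 := by
  rw [Submodule.starProjection_apply_eq_zero_iff, modeSpace, Submodule.mem_orthogonal]
  intro v hv
  induction hv using Submodule.span_induction with
  | mem v hv =>
    obtain ⟨k, hk, rfl⟩ := hv
    exact hφ.2 (fun e => by subst e; exact absurd hk (not_lt.2 hi))
  | zero => simp
  | add a b _ _ ha hb => rw [inner_add_left, ha, hb, add_zero]
  | smul c a _ ha => rw [real_inner_smul_left, ha, mul_zero]

/-- The POD projection is the orthogonal projection onto the span of the modes. -/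
theorem podProj_eq_starProjection {p : ℕ} {φ : Fin p → X} (hφ : Orthonormal ℝ φ) (r : ℕ) (x : X) :
    podProj φ r x = (modeSpace φ r).starProjection x := by
  symm
  apply Submodule.eq_starProjection_of_mem_of_inner_eq_zero
  · refine Submodule.sum_mem _ fun i hi => Submodule.smul_mem _ _ (Submodule.subset_span ?_)
    exact ⟨i, (Finset.mem_filter.1 hi).2, rfl⟩
  · intro v hv
    induction hv using Submodule.span_induction with
    | mem v hv =>
      obtain ⟨k, hk, rfl⟩ := hv
      rw [inner_sub_left, podProj, sum_inner]
      simp only [real_inner_smul_left, orthonormal_iff_ite.1 hφ, mul_ite, mul_one, mul_zero]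
      rw [Finset.sum_ite_eq', if_pos, sub_self]
      exact Finset.mem_filter.2 ⟨Finset.mem_univ _, hk⟩
    | zero => simp
    | add a b _ _ ha hb => rw [inner_add_right, ha, hb, add_zero]
    | smul c a _ ha => rw [real_inner_smul_right, ha, mul_zero]

/-- A discrete version of `‖y(t)‖² ≤ 2 ‖y(0)‖² + 2 T ∫ ‖y'‖²`. -/
theorem norm_sq_le_of_differenceQuotients {m : ℕ} {τ : ℝ} (hτ : 0 < τ) (y : Fin (m + 1) → Y)
    (k : Fin (m + 1)) :
    ‖y k‖ ^ 2 ≤ 2 * ‖y 0‖ ^ 2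
      + 2 * (m * τ) * ∑ n : Fin m, τ * ‖(1 / τ) • (y n.succ - y n.castSucc)‖ ^ 2 := by
  set z : Fin m → Y := fun n => (1 / τ) • (y n.succ - y n.castSucc) with hz
  have hstep : ∀ n : Fin m, ‖y n.succ‖ ≤ ‖y n.castSucc‖ + τ * ‖z n‖ := by
    intro n
    have : τ * ‖z n‖ = ‖y n.succ - y n.castSucc‖ := by
      rw [hz, norm_smul, Real.norm_eq_abs, abs_of_pos (by positivity)]
      field_simp
    rw [this]
    linarith [norm_sub_norm_le (y n.succ) (y n.castSucc)]
  have h1 := le_add_sum_of_succ_le (fun k => ‖y k‖) (fun n => τ * ‖z n‖)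
    (fun n => by positivity) hstep k
  have h2 : (∑ n, τ * ‖z n‖) ^ 2 ≤ (m * τ) * ∑ n, τ * ‖z n‖ ^ 2 := by
    have := sq_sum_le_card_mul_sum_sq (s := Finset.univ) (f := fun n => τ * ‖z n‖)
    rw [Finset.card_univ, Fintype.card_fin] at this
    refine this.trans (le_of_eq ?_)
    rw [mul_assoc, Finset.mul_sum _ _ τ]
    congr 1
    exact Finset.sum_congr rfl fun n _ => by ring
  have h3 : ‖y k‖ ^ 2 ≤ (‖y 0‖ + ∑ n, τ * ‖z n‖) ^ 2 := by gcongr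
  nlinarith [sq_nonneg (‖y 0‖ - ∑ n, τ * ‖z n‖)]

/-- Energy estimate for backward Euler with zero initial value, in the norm of the time
derivative. -/
theorem backwardEuler_norm_sq_map_le {m : ℕ} {τ ν C : ℝ} (hτ : 0 < τ) (hν : 0 < ν) (hC : 0 < C)
    (J : X →ₗ[ℝ] Y) (hJ : ∀ v, ‖J v‖ ^ 2 ≤ C * ‖v‖ ^ 2) {W : Submodule ℝ X}
    {y : Fin (m + 1) → X} {z : Fin m → Y} (hy : ∀ n, y n ∈ W) (h0 : y 0 = 0)
    (h : ∀ n : Fin m, ∀ v ∈ W, inner ℝ (J ((1 / τ) • (y n.succ - y n.castSucc))) (J v)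
      + ν * inner ℝ (y n.succ) v = inner ℝ (z n) (J v)) (k : Fin (m + 1)) :
    ‖J (y k)‖ ^ 2 ≤ C / (2 * ν) * ∑ n, τ * ‖z n‖ ^ 2 := by
  have hstep : ∀ n : Fin m, ‖J (y n.succ)‖ ^ 2
      ≤ ‖J (y n.castSucc)‖ ^ 2 + C / (2 * ν) * (τ * ‖z n‖ ^ 2) := by
    intro n
    have e := h n _ (hy n.succ)
    rw [map_smul, map_sub, real_inner_smul_left, inner_sub_left, real_inner_self_eq_norm_sq,
      real_inner_self_eq_norm_sq] at e
    have a1 := real_inner_le_norm (J (y n.castSucc)) (J (y n.succ))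
    have a2 := real_inner_le_norm (z n) (J (y n.succ))
    have a3 := hJ (y n.succ)
    set a := ‖J (y n.succ)‖
    set b := ‖J (y n.castSucc)‖
    set c := ‖z n‖
    -- Young's inequality, weighted so that `hJ` lets the viscous term absorb all of the `a ^ 2`
    -- contribution.
    have a4 : c * a ≤ C / (4 * ν) * c ^ 2 + ν / C * a ^ 2 := by
      have : C / (4 * ν) * c ^ 2 + ν / C * a ^ 2 - c * a
          = (C * c - 2 * ν * a) ^ 2 / (4 * ν * C) := by
        field_simp
        ring
      have : 0 ≤ (C * c - 2 * ν * a) ^ 2 / (4 * ν * C) := by positivity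
      linarith
    have a5 : ν / C * a ^ 2 ≤ ν * ‖y n.succ‖ ^ 2 := by
      calc ν / C * a ^ 2 ≤ ν / C * (C * ‖y n.succ‖ ^ 2) := by gcongr
        _ = ν * ‖y n.succ‖ ^ 2 := by field_simp
    have a6 : 1 / τ * (a ^ 2 - inner ℝ (J (y n.castSucc)) (J (y n.succ)))
        ≤ C / (4 * ν) * c ^ 2 := by linarith
    have a7 : a ^ 2 - inner ℝ (J (y n.castSucc)) (J (y n.succ)) ≤ τ * (C / (4 * ν) * c ^ 2) := by
      rwa [one_div, inv_mul_le_iff₀ hτ] at a6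
    have a8 : C / (2 * ν) * (τ * c ^ 2) = 2 * (τ * (C / (4 * ν) * c ^ 2)) := by
      field_simp
      ring
    rw [a8]
    -- Cauchy–Schwarz and `2ab ≤ a² + b²` give `a² - b² ≤ 2 (a² - inner)`, whence the factor 2 in
    -- `a8`.
    nlinarith [sq_nonneg (a - b)]
  have := le_add_sum_of_succ_le (fun k => ‖J (y k)‖ ^ 2)
    (fun n => C / (2 * ν) * (τ * ‖z n‖ ^ 2)) (fun n => by positivity) hstep k
  simpa [h0, ← Finset.mul_sum] using this

/-- Energy estimate for backward Euler with zero initial value, in the energy norm. -/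
theorem backwardEuler_norm_sq_le {m : ℕ} {τ ν : ℝ} (hτ : 0 < τ) (hν : 0 < ν)
    (J : X →ₗ[ℝ] Y) {W : Submodule ℝ X}
    {y : Fin (m + 1) → X} {z : Fin m → Y} (hy : ∀ n, y n ∈ W) (h0 : y 0 = 0)
    (h : ∀ n : Fin m, ∀ v ∈ W, inner ℝ (J ((1 / τ) • (y n.succ - y n.castSucc))) (J v)
      + ν * inner ℝ (y n.succ) v = inner ℝ (z n) (J v)) (k : Fin (m + 1)) :
    ‖y k‖ ^ 2 ≤ 1 / (2 * ν) * ∑ n, τ * ‖z n‖ ^ 2 := by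
  have hstep : ∀ n : Fin m, ‖y n.succ‖ ^ 2
      ≤ ‖y n.castSucc‖ ^ 2 + 1 / (2 * ν) * (τ * ‖z n‖ ^ 2) := by
    intro n
    -- The test function is the difference quotient itself, so that the viscous term telescopes in
    -- the energy norm.
    have e := h n _ (W.smul_mem (1 / τ) (W.sub_mem (hy n.succ) (hy n.castSucc)))
    have a2 := real_inner_le_norm (z n) (J ((1 / τ) • (y n.succ - y n.castSucc)))
    rw [real_inner_self_eq_norm_sq, real_inner_smul_right, inner_sub_right,
      real_inner_self_eq_norm_sq] at e
    have a1 := real_inner_le_norm (y n.succ) (y n.castSucc)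
    set a := ‖y n.succ‖
    set b := ‖y n.castSucc‖
    set c := ‖z n‖
    set q := ‖J ((1 / τ) • (y n.succ - y n.castSucc))‖
    -- From `c q ≤ q² + c²/4`: the squared time derivative `q²` absorbs the forcing, so no Poincaré
    -- constant enters.
    have a6 : 1 / τ * (ν * (a ^ 2 - inner ℝ (y n.succ) (y n.castSucc))) ≤ 1 / 4 * c ^ 2 := by
      nlinarith [sq_nonneg (c - 2 * q)]
    rw [one_div, inv_mul_le_iff₀ hτ, mul_comm ν, ← le_div_iff₀ hν] at a6
    have a8 : 1 / (2 * ν) * (τ * c ^ 2) = 2 * (τ * (1 / 4 * c ^ 2) / ν) := by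
      field_simp
      ring
    rw [a8]
    nlinarith [sq_nonneg (a - b)]
  have := le_add_sum_of_succ_le (fun k => ‖y k‖ ^ 2)
    (fun n => 1 / (2 * ν) * (τ * ‖z n‖ ^ 2)) (fun n => by positivity) hstep k
  simpa [h0, ← Finset.mul_sum] using this

end POD

/-! ### Ritz residual and discrete error of a discretization -/

namespace Discretization

variable {d : ℕ} [NeZero d] {Ω : BoundedDomain d} {ν T : ℝ}
  {Y : Type*} [NormedAddCommGroup Y] [InnerProductSpace ℝ Y]

/-- The truncated sum `∑_{i > r} λ_i ‖φ_i‖_Y²`. -/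
noncomputable def tailSum (D : Discretization Ω ν T) (J : H10 Ω →ₗ[ℝ] Y) : ℝ :=
  ∑ i ∈ D.tail, D.lam i * ‖J (D.φ i)‖ ^ 2

/-- The residual `x - R_r x` of the Ritz projection. -/
noncomputable def ritzResidual (D : Discretization Ω ν T) : H10 Ω →ₗ[ℝ] H10 Ω :=
  LinearMap.id - (D.Xr.starProjection : H10 Ω →ₗ[ℝ] H10 Ω)

theorem ritzResidual_apply (D : Discretization Ω ν T) (x : H10 Ω) :
    D.ritzResidual x = x - D.ritz x := rfl

theorem step_pos (D : Discretization Ω ν T) (hT : 0 < T) : 0 < T / D.m :=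
  div_pos hT (Nat.cast_pos.2 D.m_pos)

/-- The inner product of `H₀¹` is that of the gradients, so the POD projection defining `u_r¹` is
already the Ritz projection of `u¹`. -/
theorem initErr_eq_zero (D : Discretization Ω ν T) : D.initErr = 0 := by
  rw [initErr, D.ur_initial, podProj_eq_starProjection D.isPOD.orthonormal, ritz, sub_self]

theorem tailSum_nonneg (D : Discretization Ω ν T) (J : H10 Ω →ₗ[ℝ] Y) : 0 ≤ D.tailSum J :=
  Finset.sum_nonneg fun i _ => mul_nonneg (D.isPOD.nonneg i) (sq_nonneg _)

theorem lam_eq_zero_of_s_le (D : Discretization Ω ν T) {i : Fin D.p} (hi : D.s ≤ (i : ℕ)) :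
    D.lam i = 0 := by
  refine le_antisymm (not_lt.1 fun h => ?_) (D.isPOD.nonneg i)
  -- A positive value at `i` would force `i + 1` positive eigenvalues, more than `s`.
  have hsub : Finset.Iic i ⊆ Finset.univ.filter fun k => 0 < D.lam k := fun k hk =>
    Finset.mem_filter.2 ⟨Finset.mem_univ _,
      h.trans_le (D.isPOD.antitone (Finset.mem_Iic.1 hk))⟩
  have hc := Finset.card_le_card hsub
  rw [Fin.card_Iic, ← Fintype.card_subtype] at hc
  exact absurd (hc.trans hi) (by simp)

/-- The residual vanishes on the first `r` modes and fixes the rest; indices from `s` on carry zero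
eigenvalues. -/
theorem sum_ritzResidual (D : Discretization Ω ν T) (J : H10 Ω →ₗ[ℝ] Y) :
    ∑ i, D.lam i * ‖J (D.ritzResidual (D.φ i))‖ ^ 2 = D.tailSum J := by
  rw [tailSum, tail, Finset.sum_filter]
  refine Finset.sum_congr rfl fun i _ => ?_
  rw [ritzResidual_apply, ritz]
  by_cases hr : D.r ≤ (i : ℕ)
  · rw [starProjection_modeSpace_of_le D.isPOD.orthonormal hr, sub_zero]
    by_cases hs : (i : ℕ) < D.s
    · rw [if_pos ⟨hr, hs⟩]
    · rw [if_neg fun h => hs h.2, D.lam_eq_zero_of_s_le (not_lt.1 hs), zero_mul]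
  · rw [starProjection_modeSpace_of_lt _ (not_le.1 hr), if_neg fun h => hr h.1]
    simp

/-- The POD error formula for the Ritz projection of the data. -/
theorem ritzResidual_error (D : Discretization Ω ν T) (hT : 0 < T) (J : H10 Ω →ₗ[ℝ] Y) :
    ‖J (D.ritzResidual (D.u 0))‖ ^ 2 + ∑ n : Fin D.m, T / D.m *
      ‖J (D.ritzResidual ((1 / (T / D.m)) • (D.u n.succ - D.u n.castSucc)))‖ ^ 2
      = D.tailSum J := by
  have hγ : ∀ j : Fin (D.m + 1), 0 < (dqWeights (T / D.m) : Fin (D.m + 1) → ℝ) j := by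
    intro j
    induction j using Fin.cases with
    | zero => exact one_pos
    | succ n => exact D.step_pos hT
  have := D.isPOD.sum_norm_sq_map hγ (J ∘ₗ D.ritzResidual)
  simp only [LinearMap.comp_apply] at this
  rw [sum_ritzResidual, Fin.sum_univ_succ] at this
  simpa only [dqWeights, dqSnapshots, Fin.cons_zero, Fin.cons_succ, one_mul] using this

/-- The difference quotients of the Ritz residual are controlled by the tail of the POD sum. -/
theorem sum_dq_ritzResidual_le (D : Discretization Ω ν T) (hT : 0 < T) (J : H10 Ω →ₗ[ℝ] Y) :
    ∑ n : Fin D.m, T / D.m *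
      ‖J (D.ritzResidual ((1 / (T / D.m)) • (D.u n.succ - D.u n.castSucc)))‖ ^ 2
      ≤ D.tailSum J := by
  rw [← D.ritzResidual_error hT J]
  exact le_add_of_nonneg_left (sq_nonneg _)

/-- The pointwise error of the Ritz projection of the data. -/
theorem norm_sq_ritzResidual_le (D : Discretization Ω ν T) (hT : 0 < T) (J : H10 Ω →ₗ[ℝ] Y)
    (k : Fin (D.m + 1)) :
    ‖J (D.ritzResidual (D.u k))‖ ^ 2 ≤ (2 + 2 * T) * D.tailSum J := by
  have h := norm_sq_le_of_differenceQuotients (D.step_pos hT)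
    (fun k => J (D.ritzResidual (D.u k))) k
  have h' := D.ritzResidual_error hT J
  simp only [map_smul, map_sub] at h h'
  have hm : (D.m : ℝ) * (T / D.m) = T :=
    mul_div_cancel₀ _ (Nat.cast_pos.2 D.m_pos).ne'
  rw [hm] at h
  rw [← h']
  set S := ∑ n : Fin D.m, T / D.m * ‖(1 / (T / D.m)) •
    (J (D.ritzResidual (D.u n.succ)) - J (D.ritzResidual (D.u n.castSucc)))‖ ^ 2
  have hS : 0 ≤ S := Finset.sum_nonneg fun n _ => mul_nonneg (D.step_pos hT).le (sq_nonneg _)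
  -- The constant comes from `2a + 2TS ≤ (2 + 2T)(a + S)` for `a, S ≥ 0`.
  nlinarith [mul_nonneg hT.le (sq_nonneg ‖J (D.ritzResidual (D.u 0))‖)]

theorem Xr_le_Vh (D : Discretization Ω ν T) : D.Xr ≤ D.Vh := by
  rw [Xr, modeSpace, Submodule.span_le]
  rintro _ ⟨i, -, rfl⟩
  exact D.φ_mem i

theorem inner_ritzResidual (D : Discretization Ω ν T) (x : H10 Ω) {v : H10 Ω} (hv : v ∈ D.Xr) :
    inner ℝ (D.ritzResidual x) v = 0 :=
  Submodule.starProjection_inner_eq_zero x v hv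

/-- The discrete error `u_r^k - R_r u^k` in the reduced space. -/
noncomputable def discErr (D : Discretization Ω ν T) (k : Fin (D.m + 1)) : H10 Ω := D.ur k - D.ritz (D.u k)

theorem discErr_mem (D : Discretization Ω ν T) (k : Fin (D.m + 1)) : D.discErr k ∈ D.Xr :=
  D.Xr.sub_mem (D.ur_mem k) (Submodule.starProjection_apply_mem _ _)

theorem err_eq (D : Discretization Ω ν T) (k : Fin (D.m + 1)) :
    D.err k = D.ritzResidual (D.u k) - D.discErr k := by
  rw [err, ritzResidual_apply, discErr]
  abel

/-- The equation of backward Euler type satisfied by the discrete error. -/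
theorem discErr_equation (D : Discretization Ω ν T) (n : Fin D.m) (v : H10 Ω) (hv : v ∈ D.Xr) :
    inner ℝ (toL2 Ω ((1 / (T / D.m)) • (D.discErr n.succ - D.discErr n.castSucc))) (toL2 Ω v)
      + ν * inner ℝ (D.discErr n.succ) v
      = inner ℝ (toL2 Ω (D.ritzResidual ((1 / (T / D.m)) • (D.u n.succ - D.u n.castSucc))))
          (toL2 Ω v) := by
  -- The gradient pairing is by definition the `H₀¹` inner product; conformity `X_r ⊆ V^h` permits
  -- the same test function in both schemes.
  have h1 : _ + ν * inner ℝ (D.u n.succ) v = _ := D.backwardEuler n v (D.Xr_le_Vh hv)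
  have h2 : _ + ν * inner ℝ (D.ur n.succ) v = _ := D.rom n v hv
  have hd : ∀ k, D.discErr k = D.ur k - D.u k + D.ritzResidual (D.u k) := by
    intro k
    rw [ritzResidual_apply, discErr]
    abel
  have h3 := D.inner_ritzResidual (D.u n.succ) hv
  simp only [hd, map_smul, map_sub, map_add, inner_add_left, inner_sub_left,
    real_inner_smul_left, h3] at h1 h2 ⊢
  linear_combination h2 - h1

theorem norm_sq_err_le (D : Discretization Ω ν T) (J : H10 Ω →ₗ[ℝ] Y) (k : Fin (D.m + 1)) :
    ‖J (D.err k)‖ ^ 2 ≤ 2 * ‖J (D.ritzResidual (D.u k))‖ ^ 2 + 2 * ‖J (D.discErr k)‖ ^ 2 := by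
  rw [err_eq, map_sub]
  have h := norm_sub_le (J (D.ritzResidual (D.u k))) (J (D.discErr k))
  have h' := pow_le_pow_left₀ (norm_nonneg _) h 2
  nlinarith [sq_nonneg (‖J (D.ritzResidual (D.u k))‖ - ‖J (D.discErr k)‖)]

theorem totalErrL2_eq (D : Discretization Ω ν T) : D.totalErrL2 = D.tailSum (toL2 Ω) := by
  simp [totalErrL2, initErr_eq_zero, tailSum]

theorem totalErrH10_eq (D : Discretization Ω ν T) :
    D.totalErrH10 = D.tailSum (toL2 Ω) + D.tailSum LinearMap.id := by
  simp [totalErrH10, initErr_eq_zero, tailSum, mul_add, Finset.sum_add_distrib,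
    D.isPOD.orthonormal.1]

theorem tailSum_toL2_le {C : ℝ} (hC : ∀ v : H10 Ω, ‖toL2 Ω v‖ ^ 2 ≤ C * ‖v‖ ^ 2)
    (D : Discretization Ω ν T) : D.tailSum (toL2 Ω) ≤ C * D.tailSum LinearMap.id := by
  rw [tailSum, tailSum, Finset.mul_sum]
  refine Finset.sum_le_sum fun i _ => ?_
  calc D.lam i * ‖toL2 Ω (D.φ i)‖ ^ 2 ≤ D.lam i * (C * ‖D.φ i‖ ^ 2) :=
        mul_le_mul_of_nonneg_left (hC _) (D.isPOD.nonneg i)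
    _ = C * (D.lam i * ‖D.φ i‖ ^ 2) := by ring

/-- Discarded modes are `H₀¹`-orthogonal to the retained ones; in `L²` this can fail, hence the
extra condition on the modes there. -/
theorem projY_id_eq_zero (D : Discretization Ω ν T) {i : Fin D.p} (hi : i ∈ D.tail) :
    D.projY LinearMap.id (D.φ i) = 0 := by
  have h := starProjection_modeSpace_of_le D.isPOD.orthonormal (Finset.mem_filter.1 hi).2.1
  rw [projY, Submodule.starProjection_apply_eq_zero_iff, Submodule.map_id]
  rwa [Submodule.starProjection_apply_eq_zero_iff] at h

end Discretization

/-! ### Pointwise error bounds and optimality -/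

variable {d : ℕ} [NeZero d] {Ω : BoundedDomain d} {ν T : ℝ}

theorem exists_pos_poincare (Ω : BoundedDomain d) :
    ∃ C : ℝ, 0 < C ∧ ∀ v : H10 Ω, ‖toL2 Ω v‖ ^ 2 ≤ C * ‖v‖ ^ 2 := by
  obtain ⟨C, hC⟩ := poincare Ω
  -- Strict positivity is needed because the `L²` energy estimate divides by the constant.
  refine ⟨max C 1, lt_max_of_lt_right one_pos, fun v => (hC v).trans ?_⟩
  exact mul_le_mul_of_nonneg_right (le_max_left _ _) (sq_nonneg _)

theorem boundsPointwiseError_L2 (hν : 0 < ν) (hT : 0 < T) :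
    BoundsPointwiseError (Set.univ : Set (Discretization Ω ν T)) (toL2 Ω)
      Discretization.totalErrL2 := by
  obtain ⟨C, hC, hP⟩ := exists_pos_poincare Ω
  refine ⟨2 * (2 + 2 * T) + 2 * (C / (2 * ν)), fun D _ k => ?_⟩
  have h1 := D.norm_sq_err_le (toL2 Ω) k
  have h2 := D.norm_sq_ritzResidual_le hT (toL2 Ω) k
  -- `initErr` is `discErr 0` by definition, so its vanishing supplies the zero initial value.
  have h3 := backwardEuler_norm_sq_map_le (D.step_pos hT) hν hC (toL2 Ω) hP D.discErr_mem
    D.initErr_eq_zero D.discErr_equation k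
  have h4 := mul_le_mul_of_nonneg_left (D.sum_dq_ritzResidual_le hT (toL2 Ω))
    (show 0 ≤ C / (2 * ν) by positivity)
  rw [D.totalErrL2_eq]
  linarith

theorem boundsPointwiseError_H10 (hν : 0 < ν) (hT : 0 < T) :
    BoundsPointwiseError (Set.univ : Set (Discretization Ω ν T)) LinearMap.id
      Discretization.totalErrH10 := by
  refine ⟨2 * (2 + 2 * T) + 2 * (1 / (2 * ν)), fun D _ k => ?_⟩
  have h1 := D.norm_sq_err_le LinearMap.id k
  have h2 := D.norm_sq_ritzResidual_le hT LinearMap.id k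
  have h3 : ‖LinearMap.id (R := ℝ) (D.discErr k)‖ ^ 2 ≤ _ :=
    backwardEuler_norm_sq_le (D.step_pos hT) hν (toL2 Ω) D.discErr_mem
      D.initErr_eq_zero D.discErr_equation k
  have h4 := mul_le_mul_of_nonneg_left (D.sum_dq_ritzResidual_le hT (toL2 Ω))
    (show 0 ≤ 1 / (2 * ν) by positivity)
  -- The residual is bounded by the `H₀¹` tail and the discrete error by the `L²` tail; `h5` and
  -- `h6` supply the cross terms of constant times total error.
  have h5 := mul_nonneg (show 0 ≤ 1 / (2 * ν) by positivity) (D.tailSum_nonneg LinearMap.id)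
  have h6 := mul_nonneg (show 0 ≤ 2 * (2 + 2 * T) by positivity) (D.tailSum_nonneg (toL2 Ω))
  rw [D.totalErrH10_eq]
  linarith

theorem optimalI_L2 :
    OptimalI (Set.univ : Set (Discretization Ω ν T)) (toL2 Ω) Discretization.totalErrL2 :=
  ⟨1, fun D _ => by rw [D.totalErrL2_eq, one_mul]; exact le_rfl⟩

theorem optimalII_L2 (C₀ : ℝ) :
    OptimalII {D : Discretization Ω ν T | ∀ i ∈ D.tail, ‖toL2 Ω (D.φ i)‖ ≤
      C₀ * ‖toL2 Ω (D.φ i) - D.projY (toL2 Ω) (toL2 Ω (D.φ i))‖} (toL2 Ω)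
      Discretization.totalErrL2 := by
  refine ⟨C₀ ^ 2, fun D hD => ?_⟩
  rw [D.totalErrL2_eq, Discretization.tailSum, Finset.mul_sum]
  refine Finset.sum_le_sum fun i hi => ?_
  have h := pow_le_pow_left₀ (norm_nonneg _) (hD i hi) 2
  rw [mul_pow] at h
  rw [mul_left_comm]
  exact mul_le_mul_of_nonneg_left h (D.isPOD.nonneg i)

theorem optimalI_H10 :
    OptimalI (Set.univ : Set (Discretization Ω ν T)) LinearMap.id
      Discretization.totalErrH10 := by
  obtain ⟨C, -, hP⟩ := exists_pos_poincare Ω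
  refine ⟨C + 1, fun D _ => ?_⟩
  change _ ≤ (C + 1) * D.tailSum LinearMap.id
  rw [D.totalErrH10_eq]
  linarith [D.tailSum_toL2_le hP]

theorem optimalI_iff_optimalII_H10 (𝓓 : Set (Discretization Ω ν T))
    (Λ : Discretization Ω ν T → ℝ) :
    OptimalI 𝓓 LinearMap.id Λ ↔ OptimalII 𝓓 LinearMap.id Λ := by
  have h : ∀ D : Discretization Ω ν T, ∑ i ∈ D.tail, D.lam i *
      ‖LinearMap.id (R := ℝ) (D.φ i) - D.projY LinearMap.id (LinearMap.id (R := ℝ) (D.φ i))‖ ^ 2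
      = ∑ i ∈ D.tail, D.lam i * ‖LinearMap.id (R := ℝ) (D.φ i)‖ ^ 2 := fun D =>
    Finset.sum_congr rfl fun i hi => by
      rw [LinearMap.id_apply, D.projY_id_eq_zero hi, sub_zero]
  simp only [OptimalI, OptimalII, h]

end PODRom

theorem mainTheorem11 {d : ℕ} [NeZero d] (Ω : PODRom.BoundedDomain d) (ν T : ℝ)
    (hν : 0 < ν) (hT : 0 < T) :
    -- error norm `L²`: the bound, and optimal-I
    (PODRom.BoundsPointwiseError (Set.univ : Set (PODRom.Discretization Ω ν T)) (PODRom.toL2 Ω)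
        PODRom.Discretization.totalErrL2 ∧
      PODRom.OptimalI (Set.univ : Set (PODRom.Discretization Ω ν T)) (PODRom.toL2 Ω)
        PODRom.Discretization.totalErrL2) ∧
    -- error norm `L²`: optimal-II on every class satisfying the condition on the modes
    (∀ C₀ : ℝ, PODRom.OptimalII
        {D : PODRom.Discretization Ω ν T | ∀ i ∈ D.tail, ‖PODRom.toL2 Ω (D.φ i)‖ ≤
          C₀ * ‖PODRom.toL2 Ω (D.φ i) - D.projY (PODRom.toL2 Ω) (PODRom.toL2 Ω (D.φ i))‖}
        (PODRom.toL2 Ω) PODRom.Discretization.totalErrL2) ∧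
    -- error norm `H₀¹`: the bound, optimal-I, optimal-II
    (PODRom.BoundsPointwiseError (Set.univ : Set (PODRom.Discretization Ω ν T)) LinearMap.id
        PODRom.Discretization.totalErrH10 ∧
      PODRom.OptimalI (Set.univ : Set (PODRom.Discretization Ω ν T)) LinearMap.id
        PODRom.Discretization.totalErrH10 ∧
      PODRom.OptimalII (Set.univ : Set (PODRom.Discretization Ω ν T)) LinearMap.id
        PODRom.Discretization.totalErrH10) ∧
    -- error norm `H₀¹`: the two notions of optimality coincide
    (∀ (𝓓 : Set (PODRom.Discretization Ω ν T)) (Λ : PODRom.Discretization Ω ν T → ℝ),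
      PODRom.OptimalI 𝓓 LinearMap.id Λ ↔ PODRom.OptimalII 𝓓 LinearMap.id Λ) :=
  ⟨⟨PODRom.boundsPointwiseError_L2 hν hT, PODRom.optimalI_L2⟩, PODRom.optimalII_L2,
    ⟨PODRom.boundsPointwiseError_H10 hν hT, PODRom.optimalI_H10,
      (PODRom.optimalI_iff_optimalII_H10 _ _).1 PODRom.optimalI_H10⟩,
    PODRom.optimalI_iff_optimalII_H10⟩
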